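/- All Banach spaces are over the same scalar field, $\mathbb R$ or $\mathbb C$. Let $X$ be a Banach space and $Y\subseteq X$ a closed subspace. Let $\tau$ be the topology of uniform convergence on compact subsets of $X$, on the space $L(X)$ of bounded linear operators on $X$. The pair $(X,Y)$ has the approximation property (AP) if the identity of $X$ is the $\tau$-limit of a net of finite rank bounded linear operators $T$ on $X$ with $TY\subseteq Y$. The space $X$ has the AP if the identity of $X$ is the $\tau$-limit of a net of finite rank bounded linear operators on $X$. The space $X$ is an $\mathcal L_\infty$-space if there is $\lambda<\infty$ such that every finite dimensional subspace $E$ of $X$ is contained in a finite dimensional subspace $F$ of $X$ for which there are an $n\ge 0$ and a linear isomorphism $e:F\to\ell_\infty^n$ with $\|e\|\,\|e^{-1}\|\le\lambda$. A short exact sequence of Banach spaces $Y\xrightarrow{j}X\xrightarrow{q}Z$ consists of bounded linear operators such that $j$ is an isomorphic embedding (a linear homeomorphism onto its image), $q$ is surjective, and $\ker q=j(Y)$. **Corollary 4.** Let $Y\xrightarrow{j}X\xrightarrow{q}Z$ be a short exact sequence of Banach spaces such that $X$ is an $\mathcal L_\infty$-space and $Y$ has the AP. Then the pair $(X,j(Y))$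 has the AP, and $Z$ has the AP. In particular, if $X$ is an $\mathcal L_\infty$-space and $Y$ is a closed subspace of $X$ with the AP, then the pair $(X,Y)$ has the AP and $X/Y$ has the AP. -/

import Mathlib

namespace PairAP

open scoped CompactConvergenceCLM

section

variable {𝕜 : Type*} [RCLike 𝕜]

/-- A bounded operator regarded as a point of `L(X)` with the topology `τ` of uniform convergence
on compact sets. -/
def toTau {X : Type*} [NormedAddCommGroup X] [NormedSpace 𝕜 X] (T : X →L[𝕜] X) : X →L_c[𝕜] X :=
  UniformConvergenceCLM.ofFun (RingHom.id 𝕜) X {K : Set X | IsCompact K} T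

/-- The bounded finite rank operators on `X` that leave the subspace `Y` invariant. -/
def finiteRankPreserving {X : Type*} [NormedAddCommGroup X] [NormedSpace 𝕜 X]
    (Y : Submodule 𝕜 X) : Set (X →L[𝕜] X) :=
  {T | T.toLinearMap.HasFiniteRange ∧ ∀ y ∈ Y, T y ∈ Y}

/-- The pair `(X, Y)` has the approximation property: the identity of `X` is a limit, in the
topology of uniform convergence on compact sets, of finite rank operators leaving `Y` invariant. -/
def PairHasAP {X : Type*} [NormedAddCommGroup X] [NormedSpace 𝕜 X] (Y : Submodule 𝕜 X) : Prop :=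
  toTau (ContinuousLinearMap.id 𝕜 X) ∈ closure (toTau '' finiteRankPreserving Y)

variable (𝕜) in
/-- The approximation property of a single space `X`. -/
def HasAP (X : Type*) [NormedAddCommGroup X] [NormedSpace 𝕜 X] : Prop :=
  toTau (ContinuousLinearMap.id 𝕜 X) ∈
    closure (toTau '' {T : X →L[𝕜] X | T.toLinearMap.HasFiniteRange})

variable (𝕜) in
/-- `X` is an `𝓛_{∞,lam}`-space: every finite dimensional subspace lies in a finite dimensional
subspace `F` whose Banach-Mazur distance to some `ℓ_∞^n` (the space `Fin n → 𝕜` with its maximum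
norm) is at most `lam`; the infimum that defines this distance is attained. -/
def IsScriptLInftyWith (lam : ℝ) (X : Type*) [NormedAddCommGroup X] [NormedSpace 𝕜 X] : Prop :=
  ∀ E : Submodule 𝕜 X, FiniteDimensional 𝕜 E →
    ∃ F : Submodule 𝕜 X, E ≤ F ∧ ∃ (n : ℕ) (e : F ≃L[𝕜] (Fin n → 𝕜)),
      ‖(e : F →L[𝕜] (Fin n → 𝕜))‖ * ‖(e.symm : (Fin n → 𝕜) →L[𝕜] F)‖ ≤ lam

variable (𝕜) in
/-- `X` is an `𝓛_∞`-space. -/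
def IsScriptLInfty (X : Type*) [NormedAddCommGroup X] [NormedSpace 𝕜 X] : Prop :=
  ∃ lam : ℝ, IsScriptLInftyWith 𝕜 lam X

/-- `Y → X → Z` is a short exact sequence: `j` is an isomorphic embedding and `q` is surjective
with kernel `j Y`. -/
structure IsShortExact {Y X Z : Type*} [NormedAddCommGroup Y] [NormedSpace 𝕜 Y]
    [NormedAddCommGroup X] [NormedSpace 𝕜 X] [NormedAddCommGroup Z] [NormedSpace 𝕜 Z]
    (j : Y →L[𝕜] X) (q : X →L[𝕜] Z) : Prop where
  isEmbedding : Topology.IsEmbedding j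
  surjective : Function.Surjective q
  ker_eq_range : LinearMap.ker q.toLinearMap = LinearMap.range j.toLinearMap

end

end PairAP

namespace PairAP

open Topology Metric
open scoped CompactConvergenceCLM Pointwise

section

variable {𝕜 : Type*} [RCLike 𝕜]
variable {X : Type*} [NormedAddCommGroup X] [NormedSpace 𝕜 X]
variable {Y : Type*} [NormedAddCommGroup Y] [NormedSpace 𝕜 Y]
variable {Z : Type*} [NormedAddCommGroup Z] [NormedSpace 𝕜 Z]

/-! Fix a compact set, enlarged to a convex balanced compact `K`, and a finite rank `R` on `Y` close
to the identity on `j ⁻¹' K`. A subspace `F` that is `lam`-isomorphic to `ℓ_∞^n` and contains a fine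
net of `K` and the range of `j ∘ R` carries a projection `P` of norm at most `lam`, nearly the
identity on `K`. But `P` need not preserve `j Y`. The defect `P ∘ j - j ∘ R : Y → F` is small on `j
⁻¹' K`, so Hahn-Banach in each coordinate of `ℓ_∞^n` extends it to `V : X → F` still small on `K`.
Then `T = P - V` has finite rank, is close to the identity on `K` and satisfies `T ∘ j = j ∘ R`, so
it preserves `j Y`.

For `Z`, such operators descend through `q`, and compact subsets of `Z` lift to compact subsets of
`X`. -/

theorem toTau_id_mem_closure_iff (S : Set (X →L[𝕜] X)) :
    toTau (ContinuousLinearMap.id 𝕜 X) ∈ closure (toTau '' S) ↔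
      ∀ K : Set X, IsCompact K → ∀ ε > 0, ∃ T ∈ S, ∀ x ∈ K, ‖T x - x‖ < ε := by
  have h := (CompactConvergenceCLM.hasBasis_nhds_zero_of_basis (σ := RingHom.id 𝕜) (E := X)
    (nhds_basis_ball (x := (0 : X)))).map (toTau (ContinuousLinearMap.id 𝕜 X) + ·)
  rw [map_add_left_nhds_zero] at h
  rw [mem_closure_iff_nhds_basis h]
  constructor
  · intro H K hK ε hε
    obtain ⟨_, ⟨T, hT, rfl⟩, f, hf, hfT⟩ := H (K, ε) ⟨hK, hε⟩
    refine ⟨T, hT, fun x hx ↦ ?_⟩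
    have h1 : T x = x + f x := congrArg (fun g : X →L_c[𝕜] X ↦ g x) hfT.symm
    simpa [h1] using hf x hx
  · rintro H ⟨K, ε⟩ ⟨hK, hε⟩
    obtain ⟨T, hT, hTK⟩ := H K hK ε hε
    refine ⟨_, ⟨T, hT, rfl⟩, toTau T - toTau (ContinuousLinearMap.id 𝕜 X), fun x hx ↦ ?_, ?_⟩
    · rw [mem_ball_zero_iff]
      exact hTK x hx
    · exact add_sub_cancel _ _

theorem hasAP_iff : HasAP 𝕜 X ↔ ∀ K : Set X, IsCompact K → ∀ ε > 0,
    ∃ T : X →L[𝕜] X, T.toLinearMap.HasFiniteRange ∧ ∀ x ∈ K, ‖T x - x‖ < ε :=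
  toTau_id_mem_closure_iff _

theorem pairHasAP_iff {S : Submodule 𝕜 X} : PairHasAP S ↔ ∀ K : Set X, IsCompact K → ∀ ε > 0,
    ∃ T ∈ finiteRankPreserving S, ∀ x ∈ K, ‖T x - x‖ < ε :=
  toTau_id_mem_closure_iff _

/-! ### Extensions controlled on a compact set -/

/-- A functional on a closed subspace that is bounded by `c` on the trace of a compact absolutely
convex set `K` has an extension that is bounded by `c + η` on `K`. -/
theorem exists_extension_norm_le_on_compact [NormedSpace ℝ X] [IsScalarTower ℝ 𝕜 X]
    [CompleteSpace X] [CompleteSpace Y] {j : Y →L[𝕜] X} (hj : IsClosedEmbedding j)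
    {K : Set X} (hK : IsCompact K) (hKc : Convex ℝ K) (hKb : Balanced 𝕜 K) (hK0 : K.Nonempty)
    (f : StrongDual 𝕜 Y) {c η : ℝ} (hc : 0 ≤ c) (hη : 0 < η) (hf : ∀ y, j y ∈ K → ‖f y‖ ≤ c) :
    ∃ g : StrongDual 𝕜 X, (∀ y, g (j y) = f y) ∧ ∀ x ∈ K, ‖g x‖ ≤ c + η := by
  have hclosed : IsClosed (j '' {y | c + η ≤ ‖f y‖}) :=
    hj.isClosedMap _ (isClosed_le continuous_const f.continuous.norm)
  -- Compactness provides an open absolutely convex neighbourhood of `K` on whose trace `‖f‖ < c +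
  -- η`; its gauge is a continuous seminorm, as Hahn-Banach requires.
  obtain ⟨δ, hδ, hδK⟩ := hK.exists_thickening_subset_open hclosed.isOpen_compl (by
    rintro x hx ⟨y, hy, rfl⟩
    have := hf y hx
    simp only [Set.mem_ofPred_eq] at hy
    linarith)
  have hKU : K ⊆ thickening δ K := self_subset_thickening hδ K
  have hUc : Convex ℝ (thickening δ K) := hKc.thickening δ
  have hUb : Balanced 𝕜 (thickening δ K) := by
    rw [← add_ball_zero]
    exact hKb.add balanced_ball_zero
  have hU0 : thickening δ K ∈ 𝓝 (0 : X) :=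
    isOpen_thickening.mem_nhds (hKU (hKb.zero_mem hK0))
  have hUa : Absorbent ℝ (thickening δ K) := absorbent_nhds_zero hU0
  have hcη : 0 < c + η := by positivity
  let e := ContinuousLinearMap.equivRange hj.injective hj.isClosed_range
  have he (y : Y) : ((e y : LinearMap.range j.toLinearMap) : X) = j y := rfl
  have hdom (y : Y) : ‖f y‖ ≤ (c + η) * gauge (thickening δ K) (j y) := by
    rw [← div_le_iff₀' hcη]
    refine le_of_forall_gt fun r hr ↦ ?_
    obtain ⟨b, hb, hbr, u, hu, hbu⟩ := exists_lt_of_gauge_lt hUa hr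
    refine lt_of_le_of_lt ?_ hbr
    have hb' : ((b : 𝕜)) ≠ 0 := by exact_mod_cast hb.ne'
    have hju : j ((b : 𝕜)⁻¹ • y) = u := by
      rw [map_smul, ← hbu]
      change (b : 𝕜)⁻¹ • b • u = u
      rw [RCLike.real_smul_eq_coe_smul (K := 𝕜), inv_smul_smul₀ hb']
    have h1 : ‖f ((b : 𝕜)⁻¹ • y)‖ < c + η := by
      by_contra! h
      exact hδK (hju.symm ▸ hu) ⟨_, h, rfl⟩
    rw [map_smul, norm_smul, norm_inv, RCLike.norm_ofReal, abs_of_pos hb,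
      inv_mul_lt_iff₀ hb] at h1
    rw [div_le_iff₀' hcη]
    linarith
  let a : NNReal := ⟨c + η, hcη.le⟩
  let p : Seminorm 𝕜 X := a • gaugeSeminorm hUb hUc hUa
  have hp (x : X) : p x = (c + η) * gauge (thickening δ K) x := rfl
  obtain ⟨g, hg, hgp⟩ := Module.Dual.exists_continuous_extension_of_le_seminorm
    (LinearMap.range j.toLinearMap) ((f ∘L (e.symm : _ →L[𝕜] Y)).toLinearMap) (p := p)
    (continuous_const.mul (continuous_gauge hUc hU0)) (fun x ↦ by
      obtain ⟨y, rfl⟩ := e.surjective x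
      simpa [hp, he] using hdom y)
  refine ⟨g, fun y ↦ ?_, fun x hx ↦ (hgp x).trans ?_⟩
  · simpa [he] using hg (e y)
  · rw [hp]
    exact mul_le_of_le_one_right hcη.le (gauge_le_one_of_mem (hKU hx))

/-- By completeness, the closed convex hull of the compact balanced set `B` is compact. Inserting
`0` covers the case of empty `K`. -/
theorem exists_compact_convex_balanced_superset [NormedSpace ℝ X] [IsScalarTower ℝ 𝕜 X]
    [CompleteSpace X] {K : Set X} (hK : IsCompact K) :
    ∃ K' : Set X, K ⊆ K' ∧ IsCompact K' ∧ Convex ℝ K' ∧ Balanced 𝕜 K' ∧ K'.Nonempty := by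
  let B : Set X := closedBall (0 : 𝕜) 1 • insert 0 K
  have hB : IsCompact B := (isCompact_closedBall 0 1).smul_set (hK.insert 0)
  have hKB : insert 0 K ⊆ B := fun x hx ↦ ⟨1, by simp, x, hx, one_smul _ _⟩
  have hBb (a : 𝕜) (ha : ‖a‖ ≤ 1) : a • B ⊆ B := by
    rintro _ ⟨_, ⟨b, hb, x, hx, rfl⟩, rfl⟩
    refine ⟨a * b, ?_, x, hx, mul_smul _ _ _⟩
    simp only [mem_closedBall_zero_iff, norm_mul] at hb ⊢
    exact mul_le_one₀ ha (norm_nonneg _) hb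
  have hsub : insert 0 K ⊆ closure (convexHull ℝ B) :=
    hKB.trans ((subset_convexHull ℝ B).trans subset_closure)
  refine ⟨closure (convexHull ℝ B), (Set.subset_insert _ _).trans hsub,
    (hB.totallyBounded.convexHull).closure.isCompact_of_isClosed isClosed_closure,
    (convex_convexHull ℝ B).closure, Balanced.closure fun a ha ↦ ?_, ⟨0, hsub (Set.mem_insert _ _)⟩⟩
  have h := (a • (LinearMap.id : X →ₗ[ℝ] X)).image_convexHull B
  calc a • convexHull ℝ B = (a • (LinearMap.id : X →ₗ[ℝ] X)) '' convexHull ℝ B := rfl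
    _ = convexHull ℝ (a • B) := h
    _ ⊆ convexHull ℝ B := convexHull_mono (hBb a ha)

/-! ### Passing to the quotient -/

/-- A compact subset of the range of a surjection of Banach spaces is covered by the image of a
compact set. -/
theorem exists_compact_image_superset [CompleteSpace X] [CompleteSpace Z] (q : X →L[𝕜] Z)
    (hq : Function.Surjective q) {L : Set Z} (hL : IsCompact L) :
    ∃ K : Set X, IsCompact K ∧ L ⊆ q '' K := by
  obtain ⟨C, hC, hs⟩ := q.exists_preimage_norm_le hq
  choose s hqs hsn using hs
  have hr (n : ℕ) : (0 : ℝ) < (1 / 2) ^ n := by positivity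
  choose N hNL hN hcov using fun n : ℕ ↦ hL.finite_cover_balls (hr n)
  have hπ (n : ℕ) (z : Z) : ∃ w, z ∈ L → w ∈ N n ∧ ‖z - w‖ < (1 / 2) ^ n := by
    by_cases hz : z ∈ L
    · obtain ⟨w, hw, hzw⟩ := Set.mem_iUnion₂.1 (hcov n hz)
      exact ⟨w, fun _ ↦ ⟨hw, by rwa [mem_ball_iff_norm] at hzw⟩⟩
    · exact ⟨0, fun h ↦ absurd h hz⟩
  choose π hπ using hπ
  -- The bounded section `s` need not be continuous, so `z` is lifted by telescoping its
  -- approximations `π n z` from finite nets. The partial sums take finitely many values on `L` and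
  -- converge uniformly, so the limit has totally bounded image.
  let u (n : ℕ) (z : Z) : X := s (π (n + 1) z - π n z)
  have hu (n : ℕ) (z : Z) (hz : z ∈ L) : ‖u n z‖ ≤ 2 * C * (1 / 2) ^ n := by
    have h1 := (hπ n z hz).2
    have h2 := (hπ (n + 1) z hz).2
    have h3 : ‖π (n + 1) z - π n z‖ ≤ ‖z - π n z‖ + ‖z - π (n + 1) z‖ := by
      rw [← sub_sub_sub_cancel_left (π n z) (π (n + 1) z) z]
      exact norm_sub_le _ _
    rw [pow_succ] at h2
    calc ‖u n z‖ ≤ C * ‖π (n + 1) z - π n z‖ := hsn _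
      _ ≤ C * (2 * (1 / 2) ^ n) := by gcongr; linarith [hr n]
      _ = _ := by ring
  have hsum : Summable fun n : ℕ ↦ 2 * C * (1 / 2 : ℝ) ^ n := summable_geometric_two.mul_left _
  let S (n : ℕ) (z : Z) : X := s (π 0 z) + ∑ i ∈ Finset.range n, u i z
  let g (z : Z) : X := s (π 0 z) + ∑' i, u i z
  have hSg : TendstoUniformlyOn S g Filter.atTop L := by
    have := tendstoUniformlyOn_tsum_nat hsum hu
    rw [Metric.tendstoUniformlyOn_iff] at this ⊢
    simpa [S, g] using this
  have hqS (n : ℕ) (z : Z) : q (S n z) = π n z := by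
    simp only [S, u, map_add, map_sum, hqs]
    rw [Finset.sum_range_sub (fun i ↦ π i z), add_sub_cancel]
  have hπlim (z : Z) (hz : z ∈ L) : Filter.Tendsto (fun n ↦ π n z) Filter.atTop (𝓝 z) := by
    rw [tendsto_iff_norm_sub_tendsto_zero]
    refine squeeze_zero (fun _ ↦ norm_nonneg _) (fun n ↦ ?_)
      (tendsto_pow_atTop_nhds_zero_of_lt_one (r := (1 / 2 : ℝ)) (by norm_num) (by norm_num))
    rw [norm_sub_rev]
    exact (hπ n z hz).2.le
  have hqg (z : Z) (hz : z ∈ L) : q (g z) = z := by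
    refine tendsto_nhds_unique ?_ (hπlim z hz)
    simp only [← hqS]
    exact (q.continuous.tendsto _).comp (hSg.tendsto_at hz)
  have hfin (n : ℕ) : (S n '' L).Finite := by
    induction n with
    | zero =>
      refine ((hN 0).image s).subset ?_
      rintro _ ⟨z, hz, rfl⟩
      exact ⟨π 0 z, (hπ 0 z hz).1, by simp [S]⟩
    | succ n ih =>
      refine (ih.add (((hN (n + 1)).sub (hN n)).image s)).subset ?_
      rintro _ ⟨z, hz, rfl⟩
      refine ⟨S n z, ⟨z, hz, rfl⟩, u n z,
        ⟨_, Set.sub_mem_sub (hπ (n + 1) z hz).1 (hπ n z hz).1, rfl⟩, ?_⟩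
      simp only [S, Finset.sum_range_succ, add_assoc]
  have htb : TotallyBounded (g '' L) := by
    rw [Metric.totallyBounded_iff]
    intro ε hε
    obtain ⟨n, hn⟩ := (Metric.tendstoUniformlyOn_iff.1 hSg ε hε).exists
    refine ⟨S n '' L, hfin n, ?_⟩
    rintro _ ⟨z, hz, rfl⟩
    exact Set.mem_iUnion₂.2 ⟨S n z, ⟨z, hz, rfl⟩, hn z hz⟩
  exact ⟨closure (g '' L), htb.closure.isCompact_of_isClosed isClosed_closure,
    fun z hz ↦ ⟨g z, subset_closure ⟨z, hz, rfl⟩, hqg z hz⟩⟩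

/-- Operators preserving the kernel of a surjection of Banach spaces descend to its range. -/
theorem exists_descent [CompleteSpace X] [CompleteSpace Z] (q : X →L[𝕜] Z)
    (hq : Function.Surjective q) (T : X →L[𝕜] X) (hT : ∀ x, q x = 0 → q (T x) = 0) :
    ∃ U : Z →L[𝕜] Z, U ∘L q = q ∘L T := by
  let U : Z →ₗ[𝕜] Z := ((LinearMap.ker q.toLinearMap).liftQ (q ∘L T).toLinearMap fun x hx ↦ hT x hx)
    ∘ₗ (q.toLinearMap.quotKerEquivOfSurjective hq).symm.toLinearMap
  have hU (x : X) : U (q x) = q (T x) := by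
    have : (q.toLinearMap.quotKerEquivOfSurjective hq).symm (q x) = Submodule.Quotient.mk x := by
      rw [LinearEquiv.symm_apply_eq]; rfl
    simp [U, this]
  refine ⟨⟨U, (q.isQuotientMap hq).continuous_iff.2 ?_⟩, ?_⟩
  · exact (q ∘L T).continuous.congr fun x ↦ (hU x).symm
  · ext x
    exact hU x

theorem PairHasAP.hasAP_of_surjective [CompleteSpace X] [CompleteSpace Z] (q : X →L[𝕜] Z)
    (hq : Function.Surjective q) (h : PairHasAP (LinearMap.ker q.toLinearMap)) : HasAP 𝕜 Z := by
  rw [hasAP_iff]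
  intro L hL ε hε
  obtain ⟨K, hK, hLK⟩ := exists_compact_image_superset q hq hL
  obtain ⟨T, ⟨hTfin, hTker⟩, hTK⟩ := pairHasAP_iff.1 h K hK (ε / (‖q‖ + 1)) (by positivity)
  obtain ⟨U, hU⟩ := exists_descent q hq T hTker
  refine ⟨U, ?_, fun z hz ↦ ?_⟩
  · have h1 : LinearMap.range U.toLinearMap = LinearMap.range (q.toLinearMap ∘ₗ T.toLinearMap) := by
      rw [← LinearMap.range_comp_of_range_eq_top U.toLinearMap (LinearMap.range_eq_top.2 hq)]
      exact congrArg (fun A : X →L[𝕜] Z ↦ LinearMap.range A.toLinearMap) hU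
    have h2 := hTfin.comp_left q.toLinearMap
    rw [LinearMap.hasFiniteRange_iff_range] at h2 ⊢
    rwa [h1]
  · obtain ⟨x, hx, rfl⟩ := hLK hz
    have h1 : U (q x) = q (T x) := congrArg (fun A : X →L[𝕜] Z ↦ A x) hU
    have h2 := hTK x hx
    rw [lt_div_iff₀ (by positivity)] at h2
    calc ‖U (q x) - q x‖ = ‖q (T x - x)‖ := by rw [h1, map_sub]
      _ ≤ ‖q‖ * ‖T x - x‖ := q.le_opNorm _
      _ ≤ ‖T x - x‖ * (‖q‖ + 1) := by nlinarith [norm_nonneg (T x - x)]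
      _ < ε := h2

/-! ### Hahn-Banach with values in `ℓ_∞^n` -/

theorem norm_apply_symm_pi_le {F : Type*} [NormedAddCommGroup F] [NormedSpace 𝕜 F] {n : ℕ}
    (e : F ≃L[𝕜] (Fin n → 𝕜)) (g : Fin n → StrongDual 𝕜 X) {x : X} {c : ℝ} (hc : 0 ≤ c)
    (h : ∀ i, ‖g i x‖ ≤ c) :
    ‖e.symm (ContinuousLinearMap.pi g x)‖ ≤ ‖(e.symm : (Fin n → 𝕜) →L[𝕜] F)‖ * c :=
  ((e.symm : (Fin n → 𝕜) →L[𝕜] F).le_opNorm _).trans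
    (mul_le_mul_of_nonneg_left ((pi_norm_le_iff_of_nonneg hc).2 h) (norm_nonneg _))

theorem norm_coord_le {F : Type*} [NormedAddCommGroup F] [NormedSpace 𝕜 F] {n : ℕ}
    (e : F ≃L[𝕜] (Fin n → 𝕜)) (i : Fin n) (w : F) :
    ‖e w i‖ ≤ ‖(e : F →L[𝕜] (Fin n → 𝕜))‖ * ‖w‖ :=
  (norm_le_pi_norm (e w) i).trans ((e : F →L[𝕜] (Fin n → 𝕜)).le_opNorm w)

/-- A subspace isomorphic to `ℓ_∞^n` is the range of a projection bounded by the distance. -/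
theorem exists_projection {F : Submodule 𝕜 X} {n : ℕ} (e : F ≃L[𝕜] (Fin n → 𝕜)) :
    ∃ P : X →L[𝕜] F, (∀ w : F, P w = w) ∧
      ∀ x, ‖P x‖ ≤ ‖(e : F →L[𝕜] (Fin n → 𝕜))‖ * ‖(e.symm : (Fin n → 𝕜) →L[𝕜] F)‖ * ‖x‖ := by
  choose g hg hgn using fun i : Fin n ↦ exists_extension_norm_eq F
    (ContinuousLinearMap.proj (R := 𝕜) (φ := fun _ : Fin n ↦ 𝕜) i ∘L (e : F →L[𝕜] (Fin n → 𝕜)))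
  refine ⟨(e.symm : (Fin n → 𝕜) →L[𝕜] F) ∘L ContinuousLinearMap.pi g, fun w ↦ ?_, fun x ↦ ?_⟩
  · have : ContinuousLinearMap.pi g w = e w := funext fun i ↦ hg i w
    simp [this]
  · refine (norm_apply_symm_pi_le e g (c := ‖(e : F →L[𝕜] (Fin n → 𝕜))‖ * ‖x‖) (by positivity)
      fun i ↦ ((g i).le_opNorm x).trans ?_).trans_eq (by ring)
    gcongr
    rw [hgn]
    exact ContinuousLinearMap.opNorm_le_bound _ (norm_nonneg _) (norm_coord_le e i)

/-- Vector-valued form of `exists_extension_norm_le_on_compact`, with values in a space isomorphic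
to `ℓ_∞^n`. -/
theorem exists_extension_norm_le_on_compact_of_equiv_pi [NormedSpace ℝ X] [IsScalarTower ℝ 𝕜 X]
    [CompleteSpace X] [CompleteSpace Y] {j : Y →L[𝕜] X} (hj : IsClosedEmbedding j)
    {K : Set X} (hK : IsCompact K) (hKc : Convex ℝ K) (hKb : Balanced 𝕜 K) (hK0 : K.Nonempty)
    {F : Type*} [NormedAddCommGroup F] [NormedSpace 𝕜 F] {n : ℕ} (e : F ≃L[𝕜] (Fin n → 𝕜))
    (v : Y →L[𝕜] F) {c η : ℝ} (hc : 0 ≤ c) (hη : 0 < η) (hv : ∀ y, j y ∈ K → ‖v y‖ ≤ c) :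
    ∃ V : X →L[𝕜] F, (∀ y, V (j y) = v y) ∧ ∀ x ∈ K,
      ‖V x‖ ≤ ‖(e : F →L[𝕜] (Fin n → 𝕜))‖ * ‖(e.symm : (Fin n → 𝕜) →L[𝕜] F)‖ * c + η := by
  set a := ‖(e : F →L[𝕜] (Fin n → 𝕜))‖
  set b := ‖(e.symm : (Fin n → 𝕜) →L[𝕜] F)‖
  have hb : 0 ≤ b := norm_nonneg _
  -- The `+ 1` avoids dividing by zero: `b = 0` when `n = 0`.
  have hη' : 0 < η / (b + 1) := by positivity
  choose g hg hgK using fun i : Fin n ↦ exists_extension_norm_le_on_compact hj hK hKc hKb hK0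
    (ContinuousLinearMap.proj (R := 𝕜) (φ := fun _ : Fin n ↦ 𝕜) i ∘L
      (e : F →L[𝕜] (Fin n → 𝕜)) ∘L v) (c := a * c) (by positivity) hη'
    (fun y hy ↦ (norm_coord_le e i (v y)).trans (by gcongr; exact hv y hy))
  refine ⟨(e.symm : (Fin n → 𝕜) →L[𝕜] F) ∘L ContinuousLinearMap.pi g, fun y ↦ ?_, fun x hx ↦ ?_⟩
  · have : ContinuousLinearMap.pi g (j y) = e (v y) := funext fun i ↦ hg i y
    simp [this]
  · refine (norm_apply_symm_pi_le e g (c := a * c + η / (b + 1)) (by positivity)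
      fun i ↦ hgK i x hx).trans ?_
    have h1 : b * (η / (b + 1)) ≤ η := by
      rw [mul_div_assoc', div_le_iff₀ (by positivity)]
      nlinarith
    calc b * (a * c + η / (b + 1)) = a * b * c + b * (η / (b + 1)) := by ring
      _ ≤ a * b * c + η := by gcongr

/-! ### The approximation property of the pair -/

theorem pairHasAP_range_of_isScriptLInfty [CompleteSpace X] [CompleteSpace Y] {j : Y →L[𝕜] X}
    (hj : IsClosedEmbedding j) (hX : IsScriptLInfty 𝕜 X) (hY : HasAP 𝕜 Y) :
    PairHasAP (LinearMap.range j.toLinearMap) := by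
  let _ : NormedSpace ℝ X := NormedSpace.restrictScalars ℝ 𝕜 X
  have : IsScalarTower ℝ 𝕜 X := RestrictScalars.isScalarTower ℝ 𝕜 X
  obtain ⟨lam, hlam⟩ := hX
  rw [pairHasAP_iff]
  intro K₀ hK₀ ε hε
  obtain ⟨K, hK₀K, hK, hKc, hKb, hKne⟩ := exists_compact_convex_balanced_superset (𝕜 := 𝕜) hK₀
  have hlam0 : 0 ≤ lam := by
    obtain ⟨F, -, n, e, he⟩ := hlam ⊥ inferInstance
    exact le_trans (by positivity) he
  -- The final error is `(lam + 1) * δ` from `P` plus `lam * (lam + 2) * δ + δ` from `V`.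
  obtain ⟨δ, hδ, hδε⟩ : ∃ δ > 0, (lam ^ 2 + 3 * lam + 2) * δ < ε := by
    refine ⟨ε / (lam ^ 2 + 3 * lam + 3), by positivity, ?_⟩
    rw [mul_div_assoc', div_lt_iff₀ (by positivity)]
    nlinarith
  obtain ⟨R, hRfin, hR⟩ := hasAP_iff.1 hY (j ⁻¹' K) (hj.isCompact_preimage hK) (δ / (‖j‖ + 1))
    (by positivity)
  have hjR (y : Y) (hy : j y ∈ K) : ‖j y - j (R y)‖ ≤ δ := by
    have h1 := (hR y hy).le
    rw [le_div_iff₀ (by positivity), norm_sub_rev] at h1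
    rw [← map_sub]
    exact (j.le_opNorm _).trans (by nlinarith [norm_nonneg (y - R y)])
  obtain ⟨t, -, htfin, htK⟩ := hK.finite_cover_balls hδ
  have hE : FiniteDimensional 𝕜
      (Submodule.span 𝕜 t ⊔ LinearMap.range (j ∘L R).toLinearMap : Submodule 𝕜 X) := by
    have h1 : FiniteDimensional 𝕜 (Submodule.span 𝕜 t) := FiniteDimensional.span_of_finite 𝕜 htfin
    have h2 : FiniteDimensional 𝕜 (LinearMap.range (j ∘L R).toLinearMap) :=
      Module.Finite.iff_fg.2 (LinearMap.hasFiniteRange_iff_range.1 (hRfin.comp_left j.toLinearMap))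
    infer_instance
  obtain ⟨F, hEF, n, e, he⟩ := hlam _ hE
  obtain ⟨P, hPF, hP⟩ := exists_projection e
  have hPlam (x : X) : ‖P x‖ ≤ lam * ‖x‖ := (hP x).trans (by gcongr)
  have hPK (x : X) (hx : x ∈ K) : ‖(P x : X) - x‖ ≤ (lam + 1) * δ := by
    obtain ⟨w, hw, hxw⟩ := Set.mem_iUnion₂.1 (htK hx)
    rw [mem_ball_iff_norm] at hxw
    have hPw : (P w : X) = w :=
      congrArg Subtype.val (hPF ⟨w, hEF (Submodule.mem_sup_left (Submodule.subset_span hw))⟩)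
    calc ‖(P x : X) - x‖ = ‖(P (x - w) : X) - (x - w)‖ := by
          rw [map_sub, Submodule.coe_sub, hPw]; congr 1; abel
      _ ≤ ‖(P (x - w) : X)‖ + ‖x - w‖ := norm_sub_le _ _
      _ ≤ lam * ‖x - w‖ + ‖x - w‖ := by gcongr; exact hPlam _
      _ = (lam + 1) * ‖x - w‖ := by ring
      _ ≤ (lam + 1) * δ := by gcongr
  let R' : Y →L[𝕜] F := (j ∘L R).codRestrict F fun y ↦ hEF (Submodule.mem_sup_right ⟨y, rfl⟩)
  obtain ⟨V, hVj, hVK⟩ := exists_extension_norm_le_on_compact_of_equiv_pi hj hK hKc hKb hKne e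
    (P ∘L j - R') (c := (lam + 2) * δ) (by positivity) hδ (fun y hy ↦ by
      calc ‖(P ∘L j - R') y‖ = ‖((P (j y) : X) - j y) + (j y - j (R y))‖ := by
            rw [sub_add_sub_cancel]; rfl
        _ ≤ (lam + 1) * δ + δ := (norm_add_le _ _).trans (add_le_add (hPK _ hy) (hjR y hy))
        _ = (lam + 2) * δ := by ring)
  have hF : FiniteDimensional 𝕜 F := e.symm.toLinearEquiv.finiteDimensional
  -- Subtracting `V` cancels the defect of `P` on `j Y`, leaving `j ∘ R` there.
  refine ⟨F.subtypeL ∘L (P - V), ⟨?_, ?_⟩, fun x hx ↦ ?_⟩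
  · exact (LinearMap.HasFiniteRange.of_isNoetherian_rng (f := (P - V).toLinearMap)).comp_left
      F.subtype
  · rintro _ ⟨y, rfl⟩
    refine ⟨R y, ?_⟩
    have h1 := congrArg Subtype.val (hVj y)
    change ((V (j y) : F) : X) = (P (j y) : X) - j (R y) at h1
    change j (R y) = (P (j y) : X) - (V (j y) : X)
    rw [h1, sub_sub_cancel]
  · have hxK := hK₀K hx
    calc ‖(P x : X) - (V x : X) - x‖ = ‖((P x : X) - x) - (V x : X)‖ := by congr 1; abel
      _ ≤ (lam + 1) * δ + (lam * ((lam + 2) * δ) + δ) := by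
        refine (norm_sub_le _ _).trans (add_le_add (hPK x hxK) ((hVK x hxK).trans ?_))
        gcongr
      _ = (lam ^ 2 + 3 * lam + 2) * δ := by ring
      _ < ε := hδε

end

end PairAP

theorem corollary4 {𝕜 : Type*} [RCLike 𝕜]
    {Y X Z : Type*}
    [NormedAddCommGroup Y] [NormedSpace 𝕜 Y] [CompleteSpace Y]
    [NormedAddCommGroup X] [NormedSpace 𝕜 X] [CompleteSpace X]
    [NormedAddCommGroup Z] [NormedSpace 𝕜 Z] [CompleteSpace Z]
    (j : Y →L[𝕜] X) (q : X →L[𝕜] Z) (hses : PairAP.IsShortExact j q)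
    (hX : PairAP.IsScriptLInfty 𝕜 X) (hY : PairAP.HasAP 𝕜 Y) :
    PairAP.PairHasAP (LinearMap.range j.toLinearMap) ∧ PairAP.HasAP 𝕜 Z := by
  have hclosed : IsClosed (Set.range j) := by
    have h : Set.range j = (LinearMap.ker q.toLinearMap : Set X) := by
      rw [hses.ker_eq_range]; rfl
    rw [h]
    exact q.isClosed_ker
  have hpair := PairAP.pairHasAP_range_of_isScriptLInfty ⟨hses.isEmbedding, hclosed⟩ hX hY
  refine ⟨hpair, PairAP.PairHasAP.hasAP_of_surjective q hses.surjective ?_⟩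
  rwa [hses.ker_eq_range]
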